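/- Let $G$ be a finite-dimensional real Lie group with Lie algebra $\mathcal G$, let $U$ be a strongly continuous unitary representation of $G$ on a separable complex Hilbert space $\mathcal H$, let $\mathcal D^\infty(U)$ be the space of vectors $\phi$ for which $g\mapsto U(g)\phi$ is $C^\infty$, and let $\mathcal M=dU(\mathcal E(\mathcal G))$ be the algebra of operators on $\mathcal D^\infty(U)$ that is the image of the complex universal enveloping algebra $\mathcal E(\mathcal G)$ under the infinitesimal representation, i.e. under the algebra homomorphism extending $dU(x)\phi=\frac{d}{dt}U(\exp tx)\phi|_{t=0}$, $x\in\mathcal G$. Let $\mathcal T_1(\mathcal M)$ be the set of trace class operators $T$ on $\mathcal H$ such that $T\mathcal H\subset\mathcal D^\infty(U)$, $T^*\mathcal H\subset\mathcal D^\infty(U)$ and $BT$, $BT^*$ are trace class for all $B\in\mathcal M$. Let the state space $\mathcal E_S(\mathcal M)$ be the set of positive operators $\rho\in\mathcal T_1(\mathcal M)$ with $\operatorname{Tr}\rho=1$, with the weak topology, i.e. the coarsest topology for which all the functions $\rho\mapsto\operatorname{Tr}(B\rho)$, $B\in\mathcal M$, are continuous. Let $A\in\mathcal M$ be essentially self-adjoint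 on $\mathcal D^\infty(U)$. If $A\neq 0$, then the set $\{\rho\in\mathcal E_S(\mathcal M):\operatorname{Tr}(A\rho)=0\}$ has empty interior in $\mathcal E_S(\mathcal M)$. More generally, for every real number $\alpha$ such that $A\neq\alpha I$, the set $\{\rho\in\mathcal E_S(\mathcal M):\operatorname{Tr}(A\rho)=\alpha\}$ has empty interior in $\mathcal E_S(\mathcal M)$. -/

import Mathlib

open scoped Manifold ContDiff TensorProduct

noncomputable section

namespace QuantumStates

section LieGroups

variable {E : Type*} [NormedAddCommGroup E] [NormedSpace ℝ E]
  {G : Type*} [TopologicalSpace G] [ChartedSpace E G] [Group G]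

/-- A smooth Lie group has the finite smoothness that Mathlib's Lie bracket on the tangent space
at the identity requires. -/
instance lieGroupMinSmoothness [LieGroup 𝓘(ℝ, E) ∞ G] :
    LieGroup 𝓘(ℝ, E) (minSmoothness ℝ 3) G := by
  rw [minSmoothness_of_isRCLikeNormedField]; infer_instance

end LieGroups

section DirectionalDerivative

variable {E : Type*} [NormedAddCommGroup E] [NormedSpace ℝ E]
  {M : Type*} [TopologicalSpace M] [ChartedSpace E M]
  {F : Type*} [NormedAddCommGroup F] [NormedSpace ℝ F]

/-- The derivative at `g` of a function on a manifold with values in a normed space, along the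
tangent vector `v` at `g`. -/
def dirDeriv (f : M → F) (g : M) (v : TangentSpace 𝓘(ℝ, E) g) : F :=
  mfderiv 𝓘(ℝ, E) 𝓘(ℝ, F) f g v

/-- The derivative along the bracket `[V, W]` is the commutator of the derivatives along `V` and
`W`. -/
theorem mfderiv_mlieBracket [CompleteSpace E] [IsManifold 𝓘(ℝ, E) ∞ M] {f : M → F}
    (hF : ContMDiff 𝓘(ℝ, E) 𝓘(ℝ, F) ∞ f) {V W : ∀ g : M, TangentSpace 𝓘(ℝ, E) g} {x : M}
    (hV : MDifferentiableAt 𝓘(ℝ, E) 𝓘(ℝ, E).tangent (fun g => (V g : TangentBundle 𝓘(ℝ, E) M)) x)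
    (hW : MDifferentiableAt 𝓘(ℝ, E) 𝓘(ℝ, E).tangent (fun g => (W g : TangentBundle 𝓘(ℝ, E) M)) x)
    {FV FW : M → F}
    (eV : ∀ g, dirDeriv f g (V g) = FV g)
    (eW : ∀ g, dirDeriv f g (W g) = FW g)
    (hFV : MDifferentiableAt 𝓘(ℝ, E) 𝓘(ℝ, F) FV x)
    (hFW : MDifferentiableAt 𝓘(ℝ, E) 𝓘(ℝ, F) FW x) :
    dirDeriv f x (VectorField.mlieBracket 𝓘(ℝ, E) V W x) =
      dirDeriv FW x (V x) - dirDeriv FV x (W x) := by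
  set φ := extChartAt 𝓘(ℝ, E) x with hφ
  have hinv : ∀ y ∈ φ.target,
      (mfderivWithin 𝓘(ℝ, E) 𝓘(ℝ, E) φ.symm (Set.range 𝓘(ℝ, E)) y).IsInvertible := fun y hy =>
    isInvertible_mfderivWithin_extChartAt_symm hy
  have hsd : ∀ y ∈ φ.target, MDifferentiableAt 𝓘(ℝ, E) 𝓘(ℝ, E) φ.symm y := by
    intro y hy
    have := (contMDiffWithinAt_extChartAt_symm_range (n := ∞) (I := 𝓘(ℝ, E)) x hy)
    simp only [modelWithCornersSelf_coe, Set.range_id, contMDiffWithinAt_univ] at this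
    exact this.mdifferentiableAt (by simp)
  -- derivative of a function read in the chart
  have key : ∀ (K : M → F), ∀ y ∈ φ.target,
      MDifferentiableAt 𝓘(ℝ, E) 𝓘(ℝ, F) K (φ.symm y) →
      ∀ Z : ∀ g : M, TangentSpace 𝓘(ℝ, E) g,
      fderiv ℝ (K ∘ φ.symm) y
        (VectorField.mpullbackWithin 𝓘(ℝ, E) 𝓘(ℝ, E) φ.symm Z Set.univ y) =
      dirDeriv K (φ.symm y) (Z (φ.symm y)) := by
    intro K y hy hK Z
    rw [show Set.range 𝓘(ℝ, E) = Set.univ by simp] at hinv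
    let B : E →L[ℝ] E := mfderivWithin 𝓘(ℝ, E) 𝓘(ℝ, E) φ.symm Set.univ y
    have hB : B = mfderiv 𝓘(ℝ, E) 𝓘(ℝ, E) φ.symm y := by
      simp only [B, mfderivWithin_univ]
      rfl
    have h2 : B.IsInvertible := hinv y hy
    let L : E →L[ℝ] F := mfderiv 𝓘(ℝ, E) 𝓘(ℝ, F) K (φ.symm y)
    have h1 : HasFDerivAt (K ∘ φ.symm) (L.comp B) y := by
      rw [hB]
      exact (hK.hasMFDerivAt.comp y (hsd y hy).hasMFDerivAt).hasFDerivAt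
    rw [h1.fderiv]
    change L (B (B.inverse (Z (φ.symm y)))) = L (Z (φ.symm y))
    obtain ⟨T, hT⟩ := h2
    rw [← hT, ContinuousLinearMap.inverse_equiv]
    exact congrArg L (T.apply_symm_apply _)
  have hx : φ x ∈ φ.target := mem_extChartAt_target x
  have hxx : φ.symm (φ x) = x := extChartAt_to_inv x
  have hnhds : φ.target ∈ nhds (φ x) := extChartAt_target_mem_nhds x
  have hFd : ∀ g, MDifferentiableAt 𝓘(ℝ, E) 𝓘(ℝ, F) f g := fun g =>
    hF.mdifferentiableAt (by simp)
  have hf : ContDiffAt ℝ ∞ (f ∘ φ.symm) (φ x) := by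
    have := (contMDiffWithinAt_extChartAt_symm_range (n := ∞) (I := 𝓘(ℝ, E)) x hx)
    simp only [modelWithCornersSelf_coe, Set.range_id, contMDiffWithinAt_univ] at this
    exact (hF.contMDiffAt.comp _ this).contDiffAt
  have dV := MDifferentiableWithinAt.differentiableWithinAt_mpullbackWithin_vectorField
    (s := Set.univ) (by simpa [mdifferentiableWithinAt_univ] using hV)
  have dW := MDifferentiableWithinAt.differentiableWithinAt_mpullbackWithin_vectorField
    (s := Set.univ) (by simpa [mdifferentiableWithinAt_univ] using hW)
  simp only [Set.preimage_univ, Set.univ_inter] at dV dW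
  rw [show Set.range 𝓘(ℝ, E) = Set.univ by simp] at dV dW
  replace dV := differentiableWithinAt_univ.1 dV
  replace dW := differentiableWithinAt_univ.1 dW
  -- near the base point, differentiation along the fields commutes with the chart
  have nearV : (fun y => fderiv ℝ (f ∘ φ.symm) y
      (VectorField.mpullbackWithin 𝓘(ℝ, E) 𝓘(ℝ, E) φ.symm V Set.univ y))
      =ᶠ[nhds (φ x)] FV ∘ φ.symm := by
    filter_upwards [hnhds] with y hy
    rw [key f y hy (hFd _) V, eV]; rfl
  have nearW : (fun y => fderiv ℝ (f ∘ φ.symm) y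
      (VectorField.mpullbackWithin 𝓘(ℝ, E) 𝓘(ℝ, E) φ.symm W Set.univ y))
      =ᶠ[nhds (φ x)] FW ∘ φ.symm := by
    filter_upwards [hnhds] with y hy
    rw [key f y hy (hFd _) W, eW]; rfl
  have main := VectorField.fderiv_apply_lieBracket hf
    (by rw [minSmoothness_of_isRCLikeNormedField]; exact ENat.LEInfty.out) dW dV
  rw [← hφ] at main
  rw [nearV.fderiv_eq, nearW.fderiv_eq, key FW (φ x) hx (by rw [hxx]; exact hFW) V,
    key FV (φ x) hx (by rw [hxx]; exact hFV) W, hxx] at main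
  rw [← main]
  have last := key f (φ x) hx (hFd _) (VectorField.mlieBracket 𝓘(ℝ, E) V W)
  rw [hxx] at last
  rw [← last]
  congr 1
  have e1 := mfderivWithin_extChartAt_symm_inverse_apply
    (I := 𝓘(ℝ, E)) (x := x) (VectorField.mlieBracket 𝓘(ℝ, E) V W x)
  rw [show Set.range 𝓘(ℝ, E) = Set.univ by simp, ← hφ] at e1
  have e2 : VectorField.mlieBracket 𝓘(ℝ, E) V W x =
      VectorField.lieBracket ℝ (VectorField.mpullbackWithin 𝓘(ℝ, E) 𝓘(ℝ, E) φ.symm V Set.univ)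
        (VectorField.mpullbackWithin 𝓘(ℝ, E) 𝓘(ℝ, E) φ.symm W Set.univ) (φ x) := by
    rw [← VectorField.mlieBracketWithin_univ, VectorField.mlieBracketWithin_apply,
      mfderiv_extChartAt_self, Set.preimage_univ, Set.univ_inter,
      show Set.range 𝓘(ℝ, E) = Set.univ by simp, ← hφ]
    have h9 : ∀ v : E, (ContinuousLinearMap.id ℝ E).inverse v = v := fun v => by
      rw [ContinuousLinearMap.inverse_id]; rfl
    exact (h9 _).trans (congrFun VectorField.lieBracketWithin_univ _)
  rw [VectorField.mpullbackWithin_apply, hxx]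
  exact e1.trans e2

end DirectionalDerivative

/-- A (strongly continuous) unitary representation of the topological group `G` on `H`. -/
structure UnitaryRep (G : Type*) [TopologicalSpace G] [Group G]
    (H : Type*) [NormedAddCommGroup H] [InnerProductSpace ℂ H] where
  toHom : G →* (H ≃ₗᵢ[ℂ] H)
  continuous_orbit : ∀ φ : H, Continuous fun g => toHom g φ

section InfinitesimalRepresentation

variable {E : Type*} [NormedAddCommGroup E] [NormedSpace ℝ E]
  {G : Type*} [TopologicalSpace G] [ChartedSpace E G] [Group G]
  {H : Type*} [NormedAddCommGroup H] [InnerProductSpace ℂ H]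

variable (E) in
/-- The space of smooth vectors of `U`: all `φ` whose orbit map `g ↦ U(g) φ` is `C^∞`. -/
def UnitaryRep.smoothVectors (U : UnitaryRep G H) : Submodule ℂ H where
  carrier := {φ | ContMDiff 𝓘(ℝ, E) 𝓘(ℝ, H) ∞ fun g => U.toHom g φ}
  zero_mem' := by simpa using (contMDiff_const : ContMDiff 𝓘(ℝ, E) 𝓘(ℝ, H) ∞ fun _ : G => (0 : H))
  add_mem' {φ ψ} hφ hψ := by
    have h : ContMDiff 𝓘(ℝ, E) 𝓘(ℝ, H) ∞ ((fun g => U.toHom g φ) + fun g => U.toHom g ψ) :=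
      ContMDiff.add (I' := 𝓘(ℝ, E)) (I := 𝓘(ℝ, H)) hφ hψ
    simpa [Pi.add_def] using h
  smul_mem' c φ hφ := by
    have h : ContMDiff 𝓘(ℝ, H) 𝓘(ℝ, H) ∞ (fun v : H => c • v) :=
      (contDiff_const_smul c).contMDiff
    simpa [Function.comp_def] using h.comp hφ

/-- `dU(x) φ`: the derivative at the identity of `g ↦ U(g) φ` along the Lie algebra element `x`. By
`UnitaryRep.hasDerivAt_curve` this is `d/dt U(exp (t x)) φ` at `t = 0`. -/
def UnitaryRep.deriv (U : UnitaryRep G H) (x : GroupLieAlgebra 𝓘(ℝ, E) G) (φ : H) : H :=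
  dirDeriv (fun g => U.toHom g φ) 1 x

/-- For every curve `γ` through the identity with velocity `x`, for instance the one-parameter group
`γ t = exp (t x)`, and every smooth vector `φ`, `dU(x) φ` is the derivative of `U(γ t) φ` at
`t = 0`. -/
theorem UnitaryRep.hasDerivAt_curve (U : UnitaryRep G H) (x : GroupLieAlgebra 𝓘(ℝ, E) G)
    {φ : H} (hφ : φ ∈ U.smoothVectors E) {γ : ℝ → G} (hγ0 : γ 0 = 1)
    (hγ : HasMFDerivAt 𝓘(ℝ, ℝ) 𝓘(ℝ, E) γ 0 (ContinuousLinearMap.toSpanSingleton ℝ (x : E))) :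
    HasDerivAt (fun t => U.toHom (γ t) φ) (U.deriv x φ) 0 := by
  let L : E →L[ℝ] H := mfderiv 𝓘(ℝ, E) 𝓘(ℝ, H) (fun g => U.toHom g φ) (1 : G)
  have h1 : ∀ k : G, k = 1 → HasMFDerivAt 𝓘(ℝ, E) 𝓘(ℝ, H) (fun g => U.toHom g φ) k L := by
    rintro _ rfl
    exact (ContMDiff.mdifferentiableAt (n := ∞) hφ (by simp)).hasMFDerivAt
  have h2 : HasFDerivAt (fun t => U.toHom (γ t) φ)
      (L.comp (ContinuousLinearMap.toSpanSingleton ℝ (x : E))) 0 :=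
    ((h1 (γ 0) hγ0).comp (0 : ℝ) hγ).hasFDerivAt
  have e : (L.comp (ContinuousLinearMap.toSpanSingleton ℝ (x : E))) (1 : ℝ) = U.deriv x φ :=
    congrArg L (one_smul ℝ (x : E))
  exact e ▸ h2.hasDerivAt

/-- Derivative of the orbit map along a left-invariant vector field. -/
theorem UnitaryRep.mfderiv_orbit [LieGroup 𝓘(ℝ, E) ∞ G] (U : UnitaryRep G H)
    (x : GroupLieAlgebra 𝓘(ℝ, E) G) {φ : H} (hφ : φ ∈ U.smoothVectors E) (g : G) :
    dirDeriv (fun g => U.toHom g φ) g (mulInvariantVectorField x g) =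
      U.toHom g (U.deriv x φ) := by
  have hd : ∀ h : G, MDifferentiableAt 𝓘(ℝ, E) 𝓘(ℝ, H) (fun g => U.toHom g φ) h := fun h =>
    ContMDiff.mdifferentiableAt (n := ∞) hφ (by simp)
  have hm : MDifferentiableAt 𝓘(ℝ, E) 𝓘(ℝ, E) (fun h : G => g * h) 1 :=
    (contMDiff_mul_left (I := 𝓘(ℝ, E)) (n := ∞)).mdifferentiableAt (by simp)
  have e : (fun h => U.toHom g (U.toHom h φ)) = (fun h => U.toHom h φ) ∘ fun h => g * h := by
    ext h; simp
  let L : H →L[ℝ] H :=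
    ((U.toHom g).toContinuousLinearEquiv : H →L[ℂ] H).restrictScalars ℝ
  have h1 : HasMFDerivAt 𝓘(ℝ, E) 𝓘(ℝ, H) (fun h => U.toHom g (U.toHom h φ)) 1
      (L.comp (mfderiv 𝓘(ℝ, E) 𝓘(ℝ, H) (fun g => U.toHom g φ) (1 : G))) :=
    HasMFDerivAt.comp (1 : G) (L.hasFDerivAt.hasMFDerivAt) (hd 1).hasMFDerivAt
  have h2 : HasMFDerivAt 𝓘(ℝ, E) 𝓘(ℝ, H) ((fun h => U.toHom h φ) ∘ fun h => g * h) 1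
      ((mfderiv 𝓘(ℝ, E) 𝓘(ℝ, H) (fun g => U.toHom g φ) (g * 1)).comp
        (mfderiv 𝓘(ℝ, E) 𝓘(ℝ, E) (fun h : G => g * h) 1)) :=
    HasMFDerivAt.comp (1 : G) (hd _).hasMFDerivAt hm.hasMFDerivAt
  rw [e] at h1
  have h3 := congrArg (fun T => T x) (hasMFDerivAt_unique h2 h1)
  rw [mul_one] at h3
  exact h3

/-- The operators `dU(x)` leave the space of smooth vectors invariant. -/
theorem UnitaryRep.deriv_mem [LieGroup 𝓘(ℝ, E) ∞ G] (U : UnitaryRep G H)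
    (x : GroupLieAlgebra 𝓘(ℝ, E) G) {φ : H} (hφ : φ ∈ U.smoothVectors E) :
    U.deriv x φ ∈ U.smoothVectors E := by
  let fg : G → TangentBundle 𝓘(ℝ, E) G := fun g => Bundle.TotalSpace.mk' E g 0
  have sfg : ContMDiff 𝓘(ℝ, E) 𝓘(ℝ, E).tangent ∞ fg := Bundle.contMDiff_zeroSection _ _
  let fv : G → TangentBundle 𝓘(ℝ, E) G := fun _ => Bundle.TotalSpace.mk' E 1 x
  have sfv : ContMDiff 𝓘(ℝ, E) 𝓘(ℝ, E).tangent ∞ fv := contMDiff_const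
  let F₁ : G → (TangentBundle 𝓘(ℝ, E) G × TangentBundle 𝓘(ℝ, E) G) := fun g => (fg g, fv g)
  have S₁ : ContMDiff 𝓘(ℝ, E) (𝓘(ℝ, E).tangent.prod 𝓘(ℝ, E).tangent) ∞ F₁ := sfg.prodMk sfv
  let F₂ : (TangentBundle 𝓘(ℝ, E) G × TangentBundle 𝓘(ℝ, E) G) →
      TangentBundle (𝓘(ℝ, E).prod 𝓘(ℝ, E)) (G × G) :=
    (equivTangentBundleProd 𝓘(ℝ, E) G 𝓘(ℝ, E) G).symm
  have S₂ : ContMDiff (𝓘(ℝ, E).tangent.prod 𝓘(ℝ, E).tangent) (𝓘(ℝ, E).prod 𝓘(ℝ, E)).tangent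
      ∞ F₂ := contMDiff_equivTangentBundleProd_symm
  let F₃ : TangentBundle (𝓘(ℝ, E).prod 𝓘(ℝ, E)) (G × G) → TangentBundle 𝓘(ℝ, E) G :=
    tangentMap (𝓘(ℝ, E).prod 𝓘(ℝ, E)) 𝓘(ℝ, E) (fun p : G × G => p.1 * p.2)
  have S₃ : ContMDiff (𝓘(ℝ, E).prod 𝓘(ℝ, E)).tangent 𝓘(ℝ, E).tangent ∞ F₃ :=
    ContMDiff.contMDiff_tangentMap (contMDiff_mul 𝓘(ℝ, E) ∞) (m := ∞) le_rfl
  let F₄ : TangentBundle 𝓘(ℝ, E) G → TangentBundle 𝓘(ℝ, H) H :=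
    tangentMap 𝓘(ℝ, E) 𝓘(ℝ, H) (fun g => U.toHom g φ)
  have S₄ : ContMDiff 𝓘(ℝ, E).tangent 𝓘(ℝ, H).tangent ∞ F₄ :=
    ContMDiff.contMDiff_tangentMap (n := ∞) hφ (m := ∞) le_rfl
  have S := (contMDiff_snd_tangentBundle_modelSpace (n := ∞) H 𝓘(ℝ, H)).comp
    (((S₄.comp S₃).comp S₂).comp S₁)
  change ContMDiff 𝓘(ℝ, E) 𝓘(ℝ, H) ∞ fun g => U.toHom g (U.deriv x φ)
  convert S using 1
  ext g
  rw [← U.mfderiv_orbit x hφ g]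
  let x' : E := x
  let m : G × G → G := fun p => p.1 * p.2
  have h5 : (mfderiv (𝓘(ℝ, E).prod 𝓘(ℝ, E)) 𝓘(ℝ, E) m (g, 1) ((0 : E), x') : E) =
      mulInvariantVectorField x g := by
    have h6 := mfderiv_prod_eq_add_apply (p := (g, (1 : G))) (v := ((0 : E), x'))
      ((contMDiff_mul 𝓘(ℝ, E) ∞).mdifferentiableAt (by simp))
    let L₁ : E →L[ℝ] E := mfderiv 𝓘(ℝ, E) 𝓘(ℝ, E) (fun z : G => z * 1) g
    let L₂ : E →L[ℝ] E := mfderiv 𝓘(ℝ, E) 𝓘(ℝ, E) (fun z : G => g * z) 1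
    have h7 : L₁ 0 + L₂ x' = L₂ x' := by rw [map_zero, zero_add]
    exact h6.trans h7
  have h8 : ∀ k : G, k = g → ∀ v : E,
      dirDeriv (E := E) (fun g => U.toHom g φ) g v = dirDeriv (E := E) (fun g => U.toHom g φ) k v := by
    rintro _ rfl _; rfl
  rw [← h5]
  exact h8 (g * 1) (mul_one g) _

/-- `dU([x, y]) = dU(x) dU(y) - dU(y) dU(x)` on smooth vectors. -/
theorem UnitaryRep.deriv_lie [CompleteSpace E] [LieGroup 𝓘(ℝ, E) ∞ G] (U : UnitaryRep G H)
    (x y : GroupLieAlgebra 𝓘(ℝ, E) G) {φ : H} (hφ : φ ∈ U.smoothVectors E) :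
    U.deriv ⁅x, y⁆ φ = U.deriv x (U.deriv y φ) - U.deriv y (U.deriv x φ) := by
  rw [GroupLieAlgebra.bracket_def]
  have h := mfderiv_mlieBracket (x := (1 : G)) (f := fun g => U.toHom g φ) hφ
    (mdifferentiableAt_mulInvariantVectorField x) (mdifferentiableAt_mulInvariantVectorField y)
    (fun g => U.mfderiv_orbit x hφ g) (fun g => U.mfderiv_orbit y hφ g)
    (ContMDiff.mdifferentiableAt (n := ∞) (U.deriv_mem x hφ) (by simp))
    (ContMDiff.mdifferentiableAt (n := ∞) (U.deriv_mem y hφ) (by simp))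
  have e1 : ∀ z : GroupLieAlgebra 𝓘(ℝ, E) G, mulInvariantVectorField z (1 : G) = z := by
    intro z
    have : (fun g : G => (1 : G) * g) = id := by ext; simp
    simp only [mulInvariantVectorField]
    rw [this, mfderiv_id]
    rfl
  rw [e1, e1] at h
  exact h

theorem UnitaryRep.mdifferentiableAt_orbit (U : UnitaryRep G H) {φ : H}
    (hφ : φ ∈ U.smoothVectors E) (g : G) :
    MDifferentiableAt 𝓘(ℝ, E) 𝓘(ℝ, H) (fun g => U.toHom g φ) g :=
  ContMDiff.mdifferentiableAt (n := ∞) hφ (by simp)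

theorem UnitaryRep.deriv_add (U : UnitaryRep G H) (x : GroupLieAlgebra 𝓘(ℝ, E) G) {φ ψ : H}
    (hφ : φ ∈ U.smoothVectors E) (hψ : ψ ∈ U.smoothVectors E) :
    U.deriv x (φ + ψ) = U.deriv x φ + U.deriv x ψ := by
  have e : (fun g => U.toHom g (φ + ψ)) = (fun g => U.toHom g φ) + fun g => U.toHom g ψ := by
    ext g; simp
  unfold UnitaryRep.deriv dirDeriv
  rw [e, mfderiv_add (U.mdifferentiableAt_orbit hφ 1) (U.mdifferentiableAt_orbit hψ 1)]
  rfl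

theorem UnitaryRep.deriv_smul (U : UnitaryRep G H) (x : GroupLieAlgebra 𝓘(ℝ, E) G) (c : ℂ) {φ : H}
    (hφ : φ ∈ U.smoothVectors E) : U.deriv x (c • φ) = c • U.deriv x φ := by
  let L : H →L[ℝ] H := (c • ContinuousLinearMap.id ℂ H).restrictScalars ℝ
  have h1 : HasMFDerivAt 𝓘(ℝ, E) 𝓘(ℝ, H) (fun h => L (U.toHom h φ)) 1
      (L.comp (mfderiv 𝓘(ℝ, E) 𝓘(ℝ, H) (fun g => U.toHom g φ) (1 : G))) :=
    HasMFDerivAt.comp (1 : G) (L.hasFDerivAt.hasMFDerivAt)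
      (U.mdifferentiableAt_orbit hφ 1).hasMFDerivAt
  have e : (fun g => U.toHom g (c • φ)) = fun g => L (U.toHom g φ) := by
    ext g; simp [L]
  unfold UnitaryRep.deriv dirDeriv
  rw [e, h1.mfderiv]
  rfl

section

variable [FiniteDimensional ℝ E] [LieGroup 𝓘(ℝ, E) ∞ G]

attribute [local instance 100] LieRing.ofAssociativeRing

/-- `dU` as a representation of the real Lie algebra of `G` on the space of smooth vectors. -/
def UnitaryRep.derivLie (U : UnitaryRep G H) :
    GroupLieAlgebra 𝓘(ℝ, E) G →ₗ⁅ℝ⁆ Module.End ℂ (U.smoothVectors E) where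
  toFun x :=
    { toFun := fun φ => ⟨U.deriv x φ, U.deriv_mem x φ.2⟩
      map_add' := fun φ ψ => Subtype.ext (U.deriv_add x φ.2 ψ.2)
      map_smul' := fun c φ => Subtype.ext (U.deriv_smul x c φ.2) }
  map_add' x y := by
    ext φ
    exact map_add (mfderiv 𝓘(ℝ, E) 𝓘(ℝ, H) (fun g => U.toHom g (φ : H)) (1 : G)) x y
  map_smul' r x := by
    ext φ
    exact map_smul (mfderiv 𝓘(ℝ, E) 𝓘(ℝ, H) (fun g => U.toHom g (φ : H)) (1 : G)) r x
  map_lie' {x y} := by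
    ext φ
    exact U.deriv_lie x y φ.2

variable (E G) in
/-- The complexification of the Lie algebra of `G`. -/
abbrev ComplexLieAlgebra : Type _ := ℂ ⊗[ℝ] GroupLieAlgebra 𝓘(ℝ, E) G

variable (E G) in
/-- The (complex) universal enveloping algebra of the Lie algebra of `G`. -/
abbrev EnvelopingAlgebra : Type _ := UniversalEnvelopingAlgebra ℂ (ComplexLieAlgebra E G)

/-- The complex-linear extension of `dU` to the complexified Lie algebra. -/
def UnitaryRep.derivLieComplex (U : UnitaryRep G H) :
    ComplexLieAlgebra E G →ₗ⁅ℂ⁆ Module.End ℂ (U.smoothVectors E) :=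
  { LinearMap.liftBaseChange ℂ (U.derivLie (E := E)).toLinearMap with
    map_lie' := by
      intro a b
      induction a using TensorProduct.induction_on with
      | zero => simp
      | add a a' ha ha' => simp_all [add_lie]
      | tmul c x =>
        induction b using TensorProduct.induction_on with
        | zero => simp
        | add b b' hb hb' => simp_all [lie_add]
        | tmul d y =>
          simp [LieAlgebra.ExtendScalars.bracket_tmul, mul_smul, LieRing.of_associative_ring_bracket,
            smul_sub, smul_comm c d] }

/-- The infinitesimal representation `dU` of the enveloping algebra on the space of smooth
vectors: the unique extension of `dU` to an algebra homomorphism. -/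
def UnitaryRep.infinitesimalRep (U : UnitaryRep G H) :
    EnvelopingAlgebra E G →ₐ[ℂ] Module.End ℂ (U.smoothVectors E) :=
  UniversalEnvelopingAlgebra.lift ℂ U.derivLieComplex

theorem UnitaryRep.infinitesimalRep_ι (U : UnitaryRep G H) (x : GroupLieAlgebra 𝓘(ℝ, E) G)
    (φ : U.smoothVectors E) :
    ((U.infinitesimalRep (E := E) (UniversalEnvelopingAlgebra.ι ℂ ((1 : ℂ) ⊗ₜ[ℝ] x)) φ :
      U.smoothVectors E) : H) =
      U.deriv x φ := by
  rw [UnitaryRep.infinitesimalRep, UniversalEnvelopingAlgebra.lift_ι_apply]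
  change ((LinearMap.liftBaseChange ℂ
    (U.derivLie (E := E)).toLinearMap (1 ⊗ₜ x) φ :) : H) = _
  simp [UnitaryRep.derivLie]

variable (E) in
/-- The algebra of operators `dU(E(𝒢))` on the space of smooth vectors. -/
def UnitaryRep.operatorAlgebra (U : UnitaryRep G H) :
    Subalgebra ℂ (Module.End ℂ (U.smoothVectors E)) :=
  (U.infinitesimalRep (E := E)).range

end

end InfinitesimalRepresentation

section StateSpace

variable {H : Type*} [NormedAddCommGroup H] [InnerProductSpace ℂ H]

/-- An operator `A : D → D` regarded as a partially defined operator on `H` with domain `D`. -/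
def toLinearPMap {D : Submodule ℂ H} (A : Module.End ℂ D) : H →ₗ.[ℂ] H :=
  ⟨D, D.subtype ∘ₗ A⟩

variable [CompleteSpace H]

/-- `A`, with domain `D`, is essentially self-adjoint: it is densely defined, symmetric (its adjoint
extends it), and its closure is self-adjoint. -/
structure IsEssentiallySelfAdjoint {D : Submodule ℂ H} (A : Module.End ℂ D) : Prop where
  dense_domain : Dense (D : Set H)
  symmetric : toLinearPMap A ≤ (toLinearPMap A).adjoint
  closure_selfAdjoint : (toLinearPMap A).closure.adjoint = (toLinearPMap A).closure

variable (H) in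
/-- An orthonormal basis of `H` (the trace does not depend on the choice). -/
def stdBasis : HilbertBasis (exists_hilbertBasis ℂ H).choose ℂ H :=
  (exists_hilbertBasis ℂ H).choose_spec.choose

/-- The trace `∑ ⟨eᵢ, L eᵢ⟩` of an everywhere defined operator. -/
def opTrace (L : H →ₗ[ℂ] H) : ℂ := ∑' i, inner ℂ (stdBasis H i) (L (stdBasis H i))

/-- `T` is trace class: the series of nonnegative terms `⟨eᵢ, |T| eᵢ⟩`, `|T| = √(T* T)`, that
defines `Tr |T|`, is finite. -/
def IsTraceClass (T : H →L[ℂ] H) : Prop :=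
  Summable fun i => (inner ℂ (stdBasis H i) (CFC.abs T (stdBasis H i)) : ℂ).re

/-- The everywhere defined operator `L` is bounded and trace class. -/
def IsTraceClassMap (L : H →ₗ[ℂ] H) : Prop :=
  ∃ T : H →L[ℂ] H, (T : H →ₗ[ℂ] H) = L ∧ IsTraceClass T

/-- The product `A T : H → H` of `A : D → D` and a bounded operator `T` with range in `D`. -/
def mulOp {D : Submodule ℂ H} (A : Module.End ℂ D) (T : H →L[ℂ] H) (hT : ∀ v, T v ∈ D) :
    H →ₗ[ℂ] H :=
  D.subtype ∘ₗ A ∘ₗ (T : H →ₗ[ℂ] H).codRestrict D hT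

/-- `T` belongs to `𝒯₁(M)`: `T` is trace class, `T` and `T*` map `H` into `D`, and `A T` and `A T*`
are trace class for all `A` in `M`. -/
structure MemTraceIdeal {D : Submodule ℂ H} (M : Subalgebra ℂ (Module.End ℂ D))
    (T : H →L[ℂ] H) : Prop where
  traceClass : IsTraceClass T
  range_mem : ∀ v, T v ∈ D
  adjoint_range_mem : ∀ v, T.adjoint v ∈ D
  mul_traceClass : ∀ A ∈ M, IsTraceClassMap (mulOp A T range_mem)
  mul_adjoint_traceClass : ∀ A ∈ M, IsTraceClassMap (mulOp A T.adjoint adjoint_range_mem)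

/-- The state space of `M`: the positive (hence self-adjoint) operators in `𝒯₁(M)` with trace
one. -/
structure State {D : Submodule ℂ H} (M : Subalgebra ℂ (Module.End ℂ D)) where
  op : H →L[ℂ] H
  mem : MemTraceIdeal M op
  pos : op.IsPositive
  trace_eq_one : opTrace (op : H →ₗ[ℂ] H) = 1

/-- The expectation value `Tr (A ρ)`. -/
def State.expect {D : Submodule ℂ H} {M : Subalgebra ℂ (Module.End ℂ D)} (ρ : State M)
    (A : Module.End ℂ D) : ℂ :=
  opTrace (mulOp A ρ.op ρ.mem.range_mem)

/-- The weak topology on the state space of `M`: the coarsest topology for which all the functions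
`ρ ↦ Tr (A ρ)`, `A` in `M`, are continuous. -/
instance State.instTopologicalSpace {D : Submodule ℂ H} (M : Subalgebra ℂ (Module.End ℂ D)) :
    TopologicalSpace (State M) :=
  ⨅ A : M, TopologicalSpace.induced (fun ρ : State M => ρ.expect (A : Module.End ℂ D)) inferInstance

end StateSpace

end QuantumStates

end

/-! For a fixed observable in the algebra, `ρ ↦ Tr (A ρ)` is an affine function on a convex set, and
an affine function that is constant near one point of a convex set is constant on all of it. Suppose
`Tr (A ρ') = α` for all `ρ'` near `ρ`. For any state `σ` the segment from `ρ` to `σ` is weakly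
continuous, so it stays near `ρ` for small `t > 0`; affinity then forces `Tr (A σ) = α`. Taking for
`σ` the pure states of unit vectors `x` in the domain gives `⟨x, A x⟩ = α`, hence `⟨x, (A - α) x⟩ =
0` on the whole domain, and complex polarization gives `A = α I`.

The analytic work lies in showing that mixtures are states and that the trace is additive on them.
Summability of `⟨eᵢ, |T| eᵢ⟩` is not visibly linear in `T`; `isTraceClass_iff` replaces it by
summability of `⟨eᵢ, V T eᵢ⟩` for every bounded `V`, which is. -/

namespace QuantumStates

/-! ### Trace class operators: a linear criterion, and additivity of the trace. -/

section TraceClass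

variable {ι : Type*} {H : Type*} [NormedAddCommGroup H] [InnerProductSpace ℂ H] [CompleteSpace H]

/-- If `‖A x‖ ≤ ‖B x‖` for all `x`, then `A` factors through `B`. -/
theorem exists_comp_eq_of_norm_le {A B : H →L[ℂ] H} (h : ∀ x, ‖A x‖ ≤ ‖B x‖) :
    ∃ V : H →L[ℂ] H, ∀ x, V (B x) = A x := by
  let K : Submodule ℂ H := (LinearMap.range (B : H →ₗ[ℂ] H)).topologicalClosure
  have : CompleteSpace K :=
    (LinearMap.range (B : H →ₗ[ℂ] H)).isClosed_topologicalClosure.completeSpace_coe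
  have hK : ∀ x, B x ∈ K := fun x =>
    (LinearMap.range (B : H →ₗ[ℂ] H)).le_topologicalClosure ⟨x, rfl⟩
  let e : H →ₗ[ℂ] K := (B : H →ₗ[ℂ] H).codRestrict K hK
  have hd : DenseRange e := by
    intro y
    rw [closure_subtype]
    have : (Subtype.val '' Set.range e : Set H) = LinearMap.range (B : H →ₗ[ℂ] H) := by
      ext z
      constructor
      · rintro ⟨_, ⟨x, rfl⟩, rfl⟩
        exact ⟨x, rfl⟩
      · rintro ⟨x, rfl⟩
        exact ⟨e x, ⟨x, rfl⟩, rfl⟩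
    rw [this]
    exact y.2
  -- `V` extends `B x ↦ A x` by continuity to the closure `K` of the range of `B`, and vanishes on
  -- the orthogonal complement of `K`.
  refine ⟨((A : H →ₗ[ℂ] H).extendOfNorm e).comp K.orthogonalProjectionOnto, fun x => ?_⟩
  have h1 : K.orthogonalProjectionOnto (B x) = e x :=
    Submodule.orthogonalProjectionOnto_mem_subspace_eq_self (e x)
  rw [ContinuousLinearMap.comp_apply, h1]
  exact LinearMap.extendOfNorm_eq hd ⟨1, fun x => by simpa [e] using h x⟩ x

/-- The Hilbert–Schmidt norm of the adjoint. -/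
theorem tsum_enorm_sq_adjoint (b : HilbertBasis ι ℂ H) (C : H →L[ℂ] H) :
    ∑' i, ENNReal.ofReal (‖C (b i)‖ ^ 2) = ∑' i, ENNReal.ofReal (‖C.adjoint (b i)‖ ^ 2) := by
  have parseval : ∀ x : H,
      ENNReal.ofReal (‖x‖ ^ 2) = ∑' j, ENNReal.ofReal (‖(inner ℂ (b j) x : ℂ)‖ ^ 2) := by
    intro x
    have h := Complex.hasSum_re (b.hasSum_inner_mul_inner x x)
    have e : (fun j => ((inner ℂ x (b j) : ℂ) * inner ℂ (b j) x).re) =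
        fun j => ‖(inner ℂ (b j) x : ℂ)‖ ^ 2 := by
      ext j
      rw [← inner_conj_symm, ← Complex.normSq_eq_conj_mul_self, Complex.ofReal_re,
        Complex.normSq_eq_norm_sq]
    rw [e] at h
    rw [← ENNReal.ofReal_tsum_of_nonneg (fun _ => by positivity) h.summable, h.tsum_eq,
      inner_self_eq_norm_sq_to_K]
    norm_cast
  simp_rw [parseval]
  -- Both sides are the double sum of `|⟨bⱼ, C bᵢ⟩|²`; with values in `ENNReal` the interchange
  -- needs no summability.
  rw [ENNReal.tsum_comm]
  congr! 5 with j i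
  rw [ContinuousLinearMap.adjoint_inner_right, ← inner_conj_symm, RCLike.norm_conj]

theorem summable_norm_sq_iff_tsum_ne_top {ι F : Type*} [NormedAddCommGroup F] {f : ι → F} :
    (Summable fun i => ‖f i‖ ^ 2) ↔ ∑' i, ENNReal.ofReal (‖f i‖ ^ 2) ≠ ⊤ :=
  ⟨fun h => h.tsum_ofReal_ne_top, fun h => by
    simpa [ENNReal.toReal_ofReal] using ENNReal.summable_toReal h⟩

/-- The Hilbert–Schmidt operators form a right ideal. -/
theorem summable_norm_sq_comp (b : HilbertBasis ι ℂ H) {C : H →L[ℂ] H}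
    (hC : Summable fun i => ‖C (b i)‖ ^ 2) (W : H →L[ℂ] H) :
    Summable fun i => ‖C (W (b i))‖ ^ 2 := by
  -- Taking adjoints turns right multiplication by `W` into left multiplication by its adjoint,
  -- where the operator norm bounds each term.
  have h1 : Summable fun i => ‖C.adjoint (b i)‖ ^ 2 := by
    rw [summable_norm_sq_iff_tsum_ne_top] at hC ⊢
    rwa [← tsum_enorm_sq_adjoint]
  have h2 : Summable fun i => ‖(C ∘L W).adjoint (b i)‖ ^ 2 := by
    refine Summable.of_nonneg_of_le (fun _ => by positivity) (fun i => ?_)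
      (h1.mul_left (‖W.adjoint‖ ^ 2))
    rw [ContinuousLinearMap.adjoint_comp, ← mul_pow]
    gcongr
    exact W.adjoint.le_opNorm _
  rw [summable_norm_sq_iff_tsum_ne_top, ← tsum_enorm_sq_adjoint,
    ← summable_norm_sq_iff_tsum_ne_top] at h2
  exact h2

/-- The squares agree because `|T|² = T* T`. With `exists_comp_eq_of_norm_le` this lets `T` and
`|T|` factor through each other, which is all that is needed of the polar decomposition. -/
theorem norm_abs_apply (T : H →L[ℂ] H) (x : H) : ‖CFC.abs T x‖ = ‖T x‖ := by
  have key : ∀ S : H →L[ℂ] H, (inner ℂ (S x) (S x) : ℂ) = inner ℂ x ((star S * S) x) := fun S => by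
    rw [ContinuousLinearMap.star_eq_adjoint, mul_apply_eq_comp,
      ContinuousLinearMap.adjoint_inner_right]
  have h : (inner ℂ (CFC.abs T x) (CFC.abs T x) : ℂ) = inner ℂ (T x) (T x) := by
    rw [key, key, (CFC.abs_nonneg T).isSelfAdjoint.star_eq, CFC.abs_mul_abs]
  rw [inner_self_eq_norm_sq_to_K, inner_self_eq_norm_sq_to_K] at h
  have h' : ‖CFC.abs T x‖ ^ 2 = ‖T x‖ ^ 2 := by exact_mod_cast h
  exact (sq_eq_sq₀ (norm_nonneg _) (norm_nonneg _)).1 h'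

/-- `T` is trace class if and only if all the products `V T` with bounded operators `V` have
a trace. -/
theorem isTraceClass_iff {T : H →L[ℂ] H} :
    IsTraceClass T ↔ ∀ V : H →L[ℂ] H,
      Summable fun i => (inner ℂ (stdBasis H i) (V (T (stdBasis H i))) : ℂ) := by
  constructor
  · intro hT V
    set b := stdBasis H
    obtain ⟨W, hW⟩ := exists_comp_eq_of_norm_le (fun x => (norm_abs_apply T x).ge)
    let C : H →L[ℂ] H := CFC.sqrt (CFC.abs T)
    have hCs : C.adjoint = C := (CFC.sqrt_nonneg (CFC.abs T)).isSelfAdjoint.star_eq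
    have hCC : ∀ x, C (C x) = CFC.abs T x := fun x =>
      congrArg (fun S : H →L[ℂ] H => S x)
        (CFC.sqrt_mul_sqrt_self (CFC.abs T) (CFC.abs_nonneg T))
    have hC : Summable fun i => ‖C (b i)‖ ^ 2 := by
      refine hT.congr fun i => ?_
      rw [← hCC, ← ContinuousLinearMap.adjoint_inner_left, hCs, inner_self_eq_norm_sq_to_K]
      norm_cast
    -- With `T = W |T|` and `C = √|T|`, the term `⟨bᵢ, V T bᵢ⟩` equals `⟨C (V W)* bᵢ, C bᵢ⟩`, which
    -- is dominated by a sum of two Hilbert–Schmidt series.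
    have hC' := summable_norm_sq_comp b hC (V ∘L W).adjoint
    refine Summable.of_norm_bounded (hC'.add hC) fun i => ?_
    have e : V (T (b i)) = (V ∘L W) (C (C (b i))) := by
      rw [hCC, ContinuousLinearMap.comp_apply, hW]
    rw [e, ← ContinuousLinearMap.adjoint_inner_left, ← ContinuousLinearMap.adjoint_inner_left, hCs]
    refine (norm_inner_le_norm _ _).trans ?_
    nlinarith [sq_nonneg (‖C ((V ∘L W).adjoint (b i))‖ - ‖C (b i)‖),
      sq_nonneg ‖C ((V ∘L W).adjoint (b i))‖, sq_nonneg ‖C (b i)‖]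
  · intro h
    -- Here `W T = |T|`, so `V = W` yields the defining series.
    obtain ⟨W, hW⟩ := exists_comp_eq_of_norm_le (fun x => (norm_abs_apply T x).le)
    have := Complex.hasSum_re (h W).hasSum
    simp_rw [hW] at this
    exact this.summable

theorem IsTraceClass.summable {T : H →L[ℂ] H} (hT : IsTraceClass T) :
    Summable fun i => (inner ℂ (stdBasis H i) (T (stdBasis H i)) : ℂ) :=
  isTraceClass_iff.1 hT (ContinuousLinearMap.id ℂ H)

theorem IsTraceClass.add {T S : H →L[ℂ] H} (hT : IsTraceClass T) (hS : IsTraceClass S) :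
    IsTraceClass (T + S) :=
  isTraceClass_iff.2 fun V => by
    simpa [inner_add_right] using (isTraceClass_iff.1 hT V).add (isTraceClass_iff.1 hS V)

theorem IsTraceClass.smul {T : H →L[ℂ] H} (hT : IsTraceClass T) (c : ℂ) :
    IsTraceClass (c • T) :=
  isTraceClass_iff.2 fun V => by
    simpa [inner_smul_right] using (isTraceClass_iff.1 hT V).mul_left c

theorem isTraceClass_rankOne (x y : H) : IsTraceClass (InnerProductSpace.rankOne ℂ x y) :=
  isTraceClass_iff.2 fun V => by
    simpa [inner_smul_right] using (stdBasis H).summable_inner_mul_inner y (V x)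

theorem IsTraceClass.isTraceClassMap {T : H →L[ℂ] H} (hT : IsTraceClass T) :
    IsTraceClassMap (T : H →ₗ[ℂ] H) :=
  ⟨T, rfl, hT⟩

theorem IsTraceClassMap.add {L K : H →ₗ[ℂ] H} (hL : IsTraceClassMap L) (hK : IsTraceClassMap K) :
    IsTraceClassMap (L + K) := by
  obtain ⟨T, rfl, hT⟩ := hL
  obtain ⟨S, rfl, hS⟩ := hK
  exact ⟨T + S, rfl, hT.add hS⟩

theorem IsTraceClassMap.smul {L : H →ₗ[ℂ] H} (hL : IsTraceClassMap L) (c : ℂ) :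
    IsTraceClassMap (c • L) := by
  obtain ⟨T, rfl, hT⟩ := hL
  exact ⟨c • T, rfl, hT.smul c⟩

theorem IsTraceClassMap.summable {L : H →ₗ[ℂ] H} (hL : IsTraceClassMap L) :
    Summable fun i => (inner ℂ (stdBasis H i) (L (stdBasis H i)) : ℂ) := by
  obtain ⟨T, rfl, hT⟩ := hL
  exact hT.summable

theorem opTrace_add {L K : H →ₗ[ℂ] H} (hL : IsTraceClassMap L) (hK : IsTraceClassMap K) :
    opTrace (L + K) = opTrace L + opTrace K := by
  simp only [opTrace, LinearMap.add_apply, inner_add_right]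
  exact hL.summable.tsum_add hK.summable

theorem opTrace_smul (L : H →ₗ[ℂ] H) (c : ℂ) : opTrace (c • L) = c * opTrace L := by
  simp only [opTrace, LinearMap.smul_apply, inner_smul_right, tsum_mul_left]

theorem opTrace_rankOne (x y : H) :
    opTrace (InnerProductSpace.rankOne ℂ x y : H →ₗ[ℂ] H) = inner ℂ y x := by
  simp only [opTrace, ContinuousLinearMap.coe_coe, InnerProductSpace.rankOne_apply,
    inner_smul_right]
  exact (stdBasis H).tsum_inner_mul_inner y x

end TraceClass

/-! ### Linear combinations and rank one elements of the trace ideal. -/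

section Convexity

variable {H : Type*} [NormedAddCommGroup H] [InnerProductSpace ℂ H] {D : Submodule ℂ H}

theorem mulOp_add_smul (B : Module.End ℂ D) {T S : H →L[ℂ] H} (hT : ∀ v, T v ∈ D)
    (hS : ∀ v, S v ∈ D) (c d : ℂ) (h : ∀ v, (c • T + d • S) v ∈ D) :
    mulOp B (c • T + d • S) h = c • mulOp B T hT + d • mulOp B S hS := by
  ext v
  have e : (⟨(c • T + d • S) v, h v⟩ : D) = c • ⟨T v, hT v⟩ + d • ⟨S v, hS v⟩ := rfl
  change ((B ⟨(c • T + d • S) v, h v⟩ : D) : H) = c • (B ⟨T v, hT v⟩ : H) + d • (B ⟨S v, hS v⟩ : H)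
  rw [e, map_add, map_smul, map_smul]
  rfl

theorem mulOp_rankOne (B : Module.End ℂ D) (x : D) (y : H)
    (h : ∀ v, InnerProductSpace.rankOne ℂ (x : H) y v ∈ D) :
    mulOp B (InnerProductSpace.rankOne ℂ (x : H) y) h =
      (InnerProductSpace.rankOne ℂ (B x : H) y : H →ₗ[ℂ] H) := by
  ext v
  have e : (⟨InnerProductSpace.rankOne ℂ (x : H) y v, h v⟩ : D) = (inner ℂ y v : ℂ) • x := rfl
  change ((B ⟨InnerProductSpace.rankOne ℂ (x : H) y v, h v⟩ : D) : H) = (inner ℂ y v : ℂ) • (B x : H)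
  rw [e, map_smul]
  rfl

variable [CompleteSpace H] {M : Subalgebra ℂ (Module.End ℂ D)}

theorem MemTraceIdeal.add_smul {T S : H →L[ℂ] H} (hT : MemTraceIdeal M T)
    (hS : MemTraceIdeal M S) (c d : ℂ) : MemTraceIdeal M (c • T + d • S) := by
  have adj : (c • T + d • S).adjoint =
      (starRingEnd ℂ) c • T.adjoint + (starRingEnd ℂ) d • S.adjoint := by
    rw [map_add, map_smulₛₗ, map_smulₛₗ]
  have h1 : ∀ v, (c • T + d • S) v ∈ D := fun v =>
    D.add_mem (D.smul_mem c (hT.range_mem v)) (D.smul_mem d (hS.range_mem v))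
  -- `mulOp` carries a proof about its operator, so the formula for the adjoint cannot simply be
  -- rewritten inside it; a variable `R` with an equation avoids this.
  have h2 : ∀ R : H →L[ℂ] H, R = (starRingEnd ℂ) c • T.adjoint + (starRingEnd ℂ) d • S.adjoint →
      ∃ h : ∀ v, R v ∈ D, ∀ A ∈ M, IsTraceClassMap (mulOp A R h) := by
    rintro _ rfl
    refine ⟨fun v => D.add_mem (D.smul_mem _ (hT.adjoint_range_mem v))
      (D.smul_mem _ (hS.adjoint_range_mem v)), fun A hA => ?_⟩
    rw [mulOp_add_smul A hT.adjoint_range_mem hS.adjoint_range_mem]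
    exact ((hT.mul_adjoint_traceClass A hA).smul _).add ((hS.mul_adjoint_traceClass A hA).smul _)
  obtain ⟨h3, h4⟩ := h2 _ adj
  refine ⟨(hT.traceClass.smul c).add (hS.traceClass.smul d), h1, h3, fun A hA => ?_, h4⟩
  rw [mulOp_add_smul A hT.range_mem hS.range_mem]
  exact ((hT.mul_traceClass A hA).smul _).add ((hS.mul_traceClass A hA).smul _)

theorem memTraceIdeal_rankOne (x : D) :
    MemTraceIdeal M (InnerProductSpace.rankOne ℂ (x : H) (x : H)) := by
  have h1 : ∀ v, InnerProductSpace.rankOne ℂ (x : H) (x : H) v ∈ D := fun v => D.smul_mem _ x.2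
  have h2 : ∀ R : H →L[ℂ] H, R = InnerProductSpace.rankOne ℂ (x : H) (x : H) →
      ∃ h : ∀ v, R v ∈ D, ∀ A ∈ M, IsTraceClassMap (mulOp A R h) := by
    rintro _ rfl
    exact ⟨h1, fun A _ => ⟨_, (mulOp_rankOne A x x h1).symm, isTraceClass_rankOne _ _⟩⟩
  obtain ⟨h3, h4⟩ := h2 _ (InnerProductSpace.adjoint_rankOne _ _)
  exact ⟨isTraceClass_rankOne _ _, h1, h3,
    fun A _ => ⟨_, (mulOp_rankOne A x x h1).symm, isTraceClass_rankOne _ _⟩, h4⟩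

/-! ### Pure states, mixtures, and the affine behaviour of expectation values. -/

/-- The pure state given by a unit vector of the domain. -/
noncomputable def State.pure (x : D) (hx : ‖x‖ = 1) : State M where
  op := InnerProductSpace.rankOne ℂ (x : H) (x : H)
  mem := memTraceIdeal_rankOne x
  pos := InnerProductSpace.isPositive_rankOne_self _
  trace_eq_one := by
    rw [opTrace_rankOne, inner_self_eq_norm_sq_to_K, Submodule.norm_coe, hx]
    simp

theorem State.expect_pure (x : D) (hx : ‖x‖ = 1) (B : Module.End ℂ D) :
    (State.pure x hx : State M).expect B = inner ℂ (x : H) (B x) := by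
  rw [State.expect, ← opTrace_rankOne]
  exact congrArg opTrace (mulOp_rankOne B x x _)

/-- The mixture `(1 - t) ρ + t σ` of two states. -/
noncomputable def State.mix (ρ σ : State M) (t : unitInterval) : State M where
  op := ((1 - t : ℝ) : ℂ) • ρ.op + ((t : ℝ) : ℂ) • σ.op
  mem := ρ.mem.add_smul σ.mem _ _
  pos := (ρ.pos.smul_of_nonneg (by exact_mod_cast unitInterval.one_minus_nonneg t)).add
    (σ.pos.smul_of_nonneg (by exact_mod_cast t.2.1))
  trace_eq_one := by
    have h := opTrace_add (ρ.mem.traceClass.isTraceClassMap.smul ((1 - t : ℝ) : ℂ))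
      (σ.mem.traceClass.isTraceClassMap.smul ((t : ℝ) : ℂ))
    rw [opTrace_smul, opTrace_smul, ρ.trace_eq_one, σ.trace_eq_one] at h
    refine h.trans ?_
    push_cast
    ring

/-- Membership in `M` makes both products trace class, so the two series converge and the trace
splits. -/
theorem State.expect_mix (ρ σ : State M) (t : unitInterval) {B : Module.End ℂ D} (hB : B ∈ M) :
    (ρ.mix σ t).expect B = ((1 - t : ℝ) : ℂ) * ρ.expect B + ((t : ℝ) : ℂ) * σ.expect B := by
  have h := opTrace_add ((ρ.mem.mul_traceClass B hB).smul ((1 - t : ℝ) : ℂ))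
    ((σ.mem.mul_traceClass B hB).smul ((t : ℝ) : ℂ))
  rw [opTrace_smul, opTrace_smul, ← mulOp_add_smul] at h
  exact h

theorem State.mix_zero (ρ σ : State M) : ρ.mix σ 0 = ρ := by
  cases ρ
  simp [State.mix]

/-- For an initial topology it suffices to test each expectation value, and these are affine in `t`.
-/
theorem State.continuous_mix (ρ σ : State M) : Continuous (ρ.mix σ) := by
  refine continuous_iInf_rng.2 fun B => continuous_induced_rng.2 ?_
  have e : (fun τ : State M => τ.expect (B : Module.End ℂ D)) ∘ ρ.mix σ = fun t : unitInterval =>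
      ((1 - t : ℝ) : ℂ) * ρ.expect B + ((t : ℝ) : ℂ) * σ.expect B :=
    funext fun t => ρ.expect_mix σ t B.2
  rw [e]
  fun_prop

/-- An observable whose expectation value is constant on a nonempty open set of states has the
same expectation value in every state. -/
theorem State.expect_eq_of_mem_interior {B : Module.End ℂ D} (hB : B ∈ M) {z : ℂ} {ρ : State M}
    (hρ : ρ ∈ interior {τ : State M | τ.expect B = z}) (σ : State M) : σ.expect B = z := by
  have h0 : ∀ᶠ t in nhds (0 : unitInterval), (ρ.mix σ t).expect B = z := by
    have h := (ρ.continuous_mix σ).tendsto 0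
    rw [ρ.mix_zero σ] at h
    exact h (mem_interior_iff_mem_nhds.1 hρ)
  -- Zero is not isolated from the right in the unit interval, so some admissible `t` is positive
  -- and can be cancelled.
  have h1 : ∃ t : unitInterval, 0 < t ∧ (ρ.mix σ t).expect B = z :=
    have := nhdsGT_neBot_of_exists_gt (⟨1, zero_lt_one⟩ : ∃ t : unitInterval, 0 < t)
    ((h0.filter_mono nhdsWithin_le_nhds).and
      (self_mem_nhdsWithin : Set.Ioi (0 : unitInterval) ∈ nhdsWithin 0 (Set.Ioi 0))).exists.imp
      fun t ht => ⟨ht.2, ht.1⟩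
  obtain ⟨t, ht, h⟩ := h1
  have hρz : ρ ∈ {τ : State M | τ.expect B = z} := interior_subset hρ
  rw [Set.mem_ofPred_eq] at hρz
  rw [ρ.expect_mix σ t hB, hρz] at h
  have ht' : ((t : ℝ) : ℂ) ≠ 0 := by
    have : (0 : ℝ) < t := ht
    exact_mod_cast this.ne'
  apply mul_left_cancel₀ ht'
  push_cast at h
  linear_combination h

/-- An observable whose expectation value is constant on a nonempty open set of states is a
multiple of the identity. -/
theorem eq_smul_one_of_mem_interior {B : Module.End ℂ D} (hB : B ∈ M) {z : ℂ} {ρ : State M}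
    (hρ : ρ ∈ interior {τ : State M | τ.expect B = z}) : B = z • (1 : Module.End ℂ D) := by
  have hunit : ∀ x : D, ‖x‖ = 1 → (inner ℂ x (B x) : ℂ) = z := fun x hx => by
    rw [← State.expect_eq_of_mem_interior hB hρ (State.pure x hx), State.expect_pure]
    rfl
  -- Over `ℂ` an operator whose quadratic form vanishes is zero, by polarization.
  rw [← sub_eq_zero, ← inner_map_self_eq_zero]
  intro x
  obtain rfl | hx := eq_or_ne x 0
  · simp
  have hx' : ((‖x‖ : ℝ) : ℂ) ≠ 0 := by exact_mod_cast norm_ne_zero_iff.2 hx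
  have h := hunit (((‖x‖ : ℝ) : ℂ)⁻¹ • x) (norm_smul_inv_norm hx)
  have h2 : (inner ℂ x (B x) : ℂ) = z * inner ℂ x x := by
    rw [map_smul, inner_smul_left, inner_smul_right, map_inv₀, Complex.conj_ofReal] at h
    rw [inner_self_eq_norm_sq_to_K, ← h]
    field_simp
    simp
  have h3 : (inner ℂ x ((B - z • (1 : Module.End ℂ D)) x) : ℂ) = 0 := by
    rw [LinearMap.sub_apply, inner_sub_right, h2]
    simp [inner_smul_right]
  rw [← inner_conj_symm, h3, map_zero]

end Convexity

end QuantumStates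

theorem proposition10
    {E : Type*} [NormedAddCommGroup E] [NormedSpace ℝ E] [FiniteDimensional ℝ E]
    {G : Type*} [TopologicalSpace G] [ChartedSpace E G] [Group G] [LieGroup 𝓘(ℝ, E) ∞ G]
    {H : Type*} [NormedAddCommGroup H] [InnerProductSpace ℂ H] [CompleteSpace H]
    [TopologicalSpace.SeparableSpace H]
    (U : QuantumStates.UnitaryRep G H)
    (A : Module.End ℂ (U.smoothVectors E)) (hA : A ∈ U.operatorAlgebra E)
    (hsa : QuantumStates.IsEssentiallySelfAdjoint A) :
    (A ≠ 0 →
      interior {ρ : QuantumStates.State (U.operatorAlgebra E) | ρ.expect A = 0} = ∅) ∧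
    (∀ α : ℝ, A ≠ (α : ℂ) • (1 : Module.End ℂ (U.smoothVectors E)) →
      interior {ρ : QuantumStates.State (U.operatorAlgebra E) | ρ.expect A = (α : ℂ)} = ∅) := by
  refine ⟨fun h => ?_, fun α h => ?_⟩
  · refine Set.eq_empty_iff_forall_notMem.2 fun ρ hρ => h ?_
    rw [QuantumStates.eq_smul_one_of_mem_interior hA hρ, zero_smul]
  · exact Set.eq_empty_iff_forall_notMem.2 fun ρ hρ =>
      h (QuantumStates.eq_smul_one_of_mem_interior hA hρ)
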